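/- Let $J'=\begin{pmatrix}0&0&1\\0&1&0\\1&0&0\end{pmatrix}$ and let $SU(2,1)(\mathbb{R})=\{g\in SL_3(\mathbb{C}) : g^tJ'\overline g=J'\}$ with the subspace topology. Let $\mathcal{H}_{\mathbb{C}}=\{\tau=(\tau_1,\tau_2)^t\in\mathbb{C}^2 : \tau_2\overline{\tau_2}+\tau_1+\overline{\tau_1}<0\}$. Write $g\in SU(2,1)(\mathbb{R})$ in blocks $g=\begin{pmatrix}A&B\\C&D\end{pmatrix}$ with $A$ of size $2\times2$ and $D$ a scalar; then $C\tau+D\neq0$ for $\tau\in\mathcal{H}_{\mathbb{C}}$, and $g(\tau)=(A\tau+B)/(C\tau+D)$ defines an action on $\mathcal{H}_{\mathbb{C}}$. Let $\widetilde{G}$ be the group of all pairs $(g,\phi)$ with $g\in SU(2,1)(\mathbb{R})$ and $\phi\colon\mathcal{H}_{\mathbb{C}}\to\mathbb{C}$ continuous with $\phi(\tau)^2=C\tau+D$ for all $\tau\in\mathcal{H}_{\mathbb{C}}$, with multiplication $(g,\phi)(g',\phi')=(gg',(\phi\circ g')\phi')$, and with the topology induced from $SU(2,1)(\mathbb{R})\times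 C(\mathcal{H}_{\mathbb{C}},\mathbb{C})$, where $C(\mathcal{H}_{\mathbb{C}},\mathbb{C})$ carries the compact-open topology. Then $\widetilde{G}$ is a topological group, and the homomorphism $\widetilde{G}\to SU(2,1)(\mathbb{R})$, $(g,\phi)\mapsto g$, is the unique connected double cover of $SU(2,1)(\mathbb{R})$. That is: it is a continuous covering map all of whose fibres have exactly two elements, $\widetilde{G}$ is connected, and the cover is non-trivial (there is no group homomorphism $s\colon SU(2,1)(\mathbb{R})\to\widetilde{G}$ with $s(g)$ lying over $g$ for all $g$). If $H$ is a connected topological group and $p\colon H\to SU(2,1)(\mathbb{R})$ is a homomorphism that is a two-sheeted covering map, then there is an isomorphism of topological groups $H\cong\widetilde{G}$ over $SU(2,1)(\mathbb{R})$. If $E$ is a connected topological space and $p\colon E\to SU(2,1)(\mathbb{R})$ is a two-sheeted covering map, then there is a homeomorphism $E\cong\widetilde{G}$ over $SU(2,1)(\mathbb{R})$. -/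

import Mathlib

open Matrix

/-- The antidiagonal matrix of the Hermitian form `⟨u, v⟩ = uᵗ J' v̄` on `ℂ³`. -/
def formMatrix : Matrix (Fin 3) (Fin 3) ℂ := !![0, 0, 1; 0, 1, 0; 1, 0, 0]

/-- The group `SU(2,1)(ℝ)` of all `g ∈ SL₃(ℂ)` with `gᵗ J' ḡ = J'`, as a subgroup of `SL₃(ℂ)`. -/
def SU21Subgroup : Subgroup (SpecialLinearGroup (Fin 3) ℂ) where
  carrier := {g | g.1ᵀ * formMatrix * g.1.map (starRingEnd ℂ) = formMatrix}
  one_mem' := by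
    change (1 : Matrix (Fin 3) (Fin 3) ℂ)ᵀ * formMatrix *
      (1 : Matrix (Fin 3) (Fin 3) ℂ).map (starRingEnd ℂ) = formMatrix
    simp
  mul_mem' := by
    intro a b ha hb
    change a.1ᵀ * formMatrix * a.1.map (starRingEnd ℂ) = formMatrix at ha
    change b.1ᵀ * formMatrix * b.1.map (starRingEnd ℂ) = formMatrix at hb
    change (a.1 * b.1)ᵀ * formMatrix * (a.1 * b.1).map (starRingEnd ℂ) = formMatrix
    rw [transpose_mul, Matrix.map_mul]
    calc _ = b.1ᵀ * (a.1ᵀ * formMatrix * a.1.map (starRingEnd ℂ)) * b.1.map (starRingEnd ℂ) := by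
          simp only [Matrix.mul_assoc]
      _ = _ := by rw [ha, hb]
  inv_mem' := by
    intro a ha
    change a.1ᵀ * formMatrix * a.1.map (starRingEnd ℂ) = formMatrix at ha
    have h0 : a.1 * a⁻¹.1 = 1 := congrArg Subtype.val (mul_inv_cancel a)
    have h1 : a⁻¹.1ᵀ * a.1ᵀ = 1 := by rw [← transpose_mul, h0, transpose_one]
    have h2 : a.1.map (starRingEnd ℂ) * a⁻¹.1.map (starRingEnd ℂ) = 1 := by
      rw [← Matrix.map_mul, h0]; simp
    change a⁻¹.1ᵀ * formMatrix * a⁻¹.1.map (starRingEnd ℂ) = formMatrix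
    calc _ = a⁻¹.1ᵀ * (a.1ᵀ * formMatrix * a.1.map (starRingEnd ℂ)) *
          a⁻¹.1.map (starRingEnd ℂ) := by rw [ha]
      _ = (a⁻¹.1ᵀ * a.1ᵀ) * formMatrix *
          (a.1.map (starRingEnd ℂ) * a⁻¹.1.map (starRingEnd ℂ)) := by simp only [Matrix.mul_assoc]
      _ = _ := by rw [h1, h2]; simp

/-- The group `SU(2,1)(ℝ)` with the topology of a subspace of the space of matrices. -/
abbrev SU21 : Type := SU21Subgroup

/-- The domain `ℋ_ℂ` of all `(τ₁, τ₂) ∈ ℂ²` with `N(τ₂) + Tr(τ₁) < 0`, where `N(z) = z z̄` and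
`Tr(z) = z + z̄`. -/
def HC : Set (ℂ × ℂ) := {τ | Complex.normSq τ.2 + 2 * τ.1.re < 0}

namespace SU21

/-- The `(i, j)` entry of `g ∈ SU(2,1)(ℝ)`. -/
def entry (g : SU21) (i j : Fin 3) : ℂ := g.1.1 i j

/-- The `i`-th coordinate of `g (τ₁, τ₂, 1)ᵗ`. -/
def coord (g : SU21) (τ : ℂ × ℂ) (i : Fin 3) : ℂ :=
  g.entry i 0 * τ.1 + g.entry i 1 * τ.2 + g.entry i 2

/-- The automorphy factor `Cτ + D`, where `(C, D)` is the last row of `g`. -/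
def denom (g : SU21) (τ : ℂ × ℂ) : ℂ :=
  g.entry 2 0 * τ.1 + g.entry 2 1 * τ.2 + g.entry 2 2

theorem entry_mul (g h : SU21) (i j : Fin 3) :
    (g * h).entry i j =
      g.entry i 0 * h.entry 0 j + g.entry i 1 * h.entry 1 j + g.entry i 2 * h.entry 2 j := by
  simp [entry, Matrix.mul_apply, Fin.sum_univ_three]

theorem entry_one (i j : Fin 3) : (1 : SU21).entry i j = if i = j then 1 else 0 := by
  simp [entry, Matrix.one_apply]

/-- `g` preserves the Hermitian form. -/
theorem form_coord (g : SU21) (τ : ℂ × ℂ) :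
    Complex.normSq (g.coord τ 1) + 2 * (g.coord τ 0 * starRingEnd ℂ (g.coord τ 2)).re =
      Complex.normSq τ.2 + 2 * τ.1.re := by
  have hg : g.1.1ᵀ * formMatrix *
    g.1.1.map (starRingEnd ℂ) = formMatrix := g.2
  have key : ∀ i j : Fin 3, g.entry 2 i * starRingEnd ℂ (g.entry 0 j) +
      g.entry 1 i * starRingEnd ℂ (g.entry 1 j) + g.entry 0 i * starRingEnd ℂ (g.entry 2 j) =
      formMatrix i j := by
    intro i j
    have := congrFun (congrFun hg i) j
    rw [← this]
    simp [Matrix.mul_apply, Fin.sum_univ_three, formMatrix, entry]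
  have hC : g.coord τ 1 * starRingEnd ℂ (g.coord τ 1) +
      (g.coord τ 0 * starRingEnd ℂ (g.coord τ 2) + g.coord τ 2 * starRingEnd ℂ (g.coord τ 0)) =
      τ.2 * starRingEnd ℂ τ.2 + (τ.1 + starRingEnd ℂ τ.1) := by
    have k00 := key 0 0
    have k01 := key 0 1
    have k02 := key 0 2
    have k10 := key 1 0
    have k11 := key 1 1
    have k12 := key 1 2
    have k20 := key 2 0
    have k21 := key 2 1
    have k22 := key 2 2
    simp [formMatrix] at k00 k01 k02 k10 k11 k12 k20 k21 k22
    simp only [coord, map_add, map_mul]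
    linear_combination τ.1 * starRingEnd ℂ τ.1 * k00 + τ.1 * starRingEnd ℂ τ.2 * k01 + τ.1 * k02 +
      τ.2 * starRingEnd ℂ τ.1 * k10 + τ.2 * starRingEnd ℂ τ.2 * k11 + τ.2 * k12 +
      starRingEnd ℂ τ.1 * k20 + starRingEnd ℂ τ.2 * k21 + k22
  have hre := congrArg Complex.re hC
  simp only [Complex.mul_conj, Complex.add_re, Complex.ofReal_re, Complex.conj_re, Complex.mul_re,
    Complex.conj_im] at hre ⊢
  linarith

theorem denom_ne_zero (g : SU21) {τ : ℂ × ℂ} (hτ : τ ∈ HC) : g.denom τ ≠ 0 := by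
  intro h
  have h1 := g.form_coord τ
  have h2 : g.coord τ 2 = 0 := h
  rw [h2] at h1
  have h3 : Complex.normSq τ.2 + 2 * τ.1.re < 0 := hτ
  have h4 := Complex.normSq_nonneg (g.coord τ 1)
  simp at h1
  linarith

/-- The fractional linear action `g(τ) = (Aτ + B) / (Cτ + D)` on `ℋ_ℂ`. -/
noncomputable def act (g : SU21) (τ : HC) : HC :=
  ⟨((g.entry 0 0 * τ.1.1 + g.entry 0 1 * τ.1.2 + g.entry 0 2) / g.denom τ,
    (g.entry 1 0 * τ.1.1 + g.entry 1 1 * τ.1.2 + g.entry 1 2) / g.denom τ), by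
    have h0 := g.denom_ne_zero τ.2
    have h1 := g.form_coord τ
    have h3 : Complex.normSq τ.1.2 + 2 * τ.1.1.re < 0 := τ.2
    have hp : 0 < Complex.normSq (g.denom τ) := Complex.normSq_pos.2 h0
    change Complex.normSq (g.coord τ 1 / g.denom τ) + 2 * (g.coord τ 0 / g.denom τ).re < 0
    have e : (g.coord τ 0 / g.denom τ).re =
        (g.coord τ 0 * starRingEnd ℂ (g.coord τ 2)).re / Complex.normSq (g.denom τ) := by
      change _ = (g.coord τ 0 * starRingEnd ℂ (g.denom τ)).re / _
      rw [Complex.div_re, Complex.mul_re, Complex.conj_re, Complex.conj_im]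
      ring
    rw [Complex.normSq_div, e, mul_div_assoc', ← add_div, h1]
    exact div_neg_of_neg_of_pos h3 hp⟩

theorem denom_one (τ : ℂ × ℂ) : (1 : SU21).denom τ = 1 := by
  simp [denom, entry_one]

theorem denom_mul (g h : SU21) (τ : HC) :
    (g * h).denom τ = g.denom (h.act τ) * h.denom τ := by
  have h0 := h.denom_ne_zero τ.2
  have e : g.denom (h.act τ) * h.denom τ =
      g.entry 2 0 * (h.entry 0 0 * τ.1.1 + h.entry 0 1 * τ.1.2 + h.entry 0 2) +
      g.entry 2 1 * (h.entry 1 0 * τ.1.1 + h.entry 1 1 * τ.1.2 + h.entry 1 2) +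
      g.entry 2 2 * h.denom τ := by
    conv_lhs => rw [denom]
    simp only [act]
    field_simp
  rw [e]
  simp only [denom, entry_mul]
  ring

theorem act_one (τ : HC) : (1 : SU21).act τ = τ := by
  apply Subtype.ext
  simp [act, denom_one, entry_one]

theorem act_mul (g h : SU21) (τ : HC) : (g * h).act τ = g.act (h.act τ) := by
  have h0 := h.denom_ne_zero τ.2
  have h1 := g.denom_ne_zero (h.act τ).2
  have h2 := denom_mul g h τ
  apply Subtype.ext
  apply Prod.ext
  · simp only [act] at h1 h2 ⊢
    rw [h2, div_eq_div_iff (mul_ne_zero h1 h0) h1]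
    simp only [entry_mul]
    field_simp
    simp only [denom]
    ring
  · simp only [act] at h1 h2 ⊢
    rw [h2, div_eq_div_iff (mul_ne_zero h1 h0) h1]
    simp only [entry_mul]
    field_simp
    simp only [denom]
    ring

theorem continuous_act (g : SU21) : Continuous g.act := by
  have h : ∀ τ : HC, g.denom τ ≠ 0 := fun τ => g.denom_ne_zero τ.2
  have hd : Continuous fun τ : HC => g.denom τ := by unfold denom; fun_prop
  unfold act
  refine Continuous.subtype_mk (Continuous.prodMk ?_ ?_) _
  · exact Continuous.div (by fun_prop) hd h
  · exact Continuous.div (by fun_prop) hd h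

end SU21

/-- The pairs `(g, φ)` with `g ∈ SU(2,1)(ℝ)` and `φ` a continuous function on `ℋ_ℂ` such that
`φ(τ)² = Cτ + D`. -/
@[ext]
structure SqrtCover where
  base : SU21
  root : C(HC, ℂ)
  root_sq : ∀ τ : HC, root τ ^ 2 = base.denom τ

namespace SqrtCover

theorem root_ne_zero (x : SqrtCover) (τ : HC) : x.root τ ≠ 0 := by
  intro h
  have := x.root_sq τ
  rw [h] at this
  exact x.base.denom_ne_zero τ.2 (by simpa using this.symm)

/-- The product `(g, φ)(g', φ') = (g g', (φ ∘ g') φ')`. -/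
noncomputable instance : Mul SqrtCover where
  mul x y :=
    { base := x.base * y.base
      root := x.root.comp ⟨y.base.act, y.base.continuous_act⟩ * y.root
      root_sq := fun τ => by
        have h1 := x.root_sq (y.base.act τ)
        have h2 := y.root_sq τ
        rw [SU21.denom_mul, ← h1, ← h2]
        simp [mul_pow] }

/-- The identity `(1, 1)`. -/
noncomputable instance : One SqrtCover where
  one := { base := 1, root := 1, root_sq := fun τ => by simp [SU21.denom_one] }

/-- The inverse `(g, φ)⁻¹ = (g⁻¹, 1 / (φ ∘ g⁻¹))`. -/
noncomputable instance : Inv SqrtCover where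
  inv x :=
    { base := x.base⁻¹
      root := ⟨fun τ => (x.root (x.base⁻¹.act τ))⁻¹, by
        refine Continuous.inv₀ ?_ fun τ => x.root_ne_zero _
        exact x.root.continuous.comp x.base⁻¹.continuous_act⟩
      root_sq := fun τ => by
        have h1 := x.root_sq (x.base⁻¹.act τ)
        have h2 := SU21.denom_mul x.base x.base⁻¹ τ
        rw [mul_inv_cancel, SU21.denom_one] at h2
        simp only [ContinuousMap.coe_mk, inv_pow, h1]
        exact inv_eq_of_mul_eq_one_right h2.symm }

noncomputable instance : Group SqrtCover :=
  Group.ofLeftAxioms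
    (fun x y z => by
      refine SqrtCover.ext (mul_assoc x.base y.base z.base) (ContinuousMap.ext fun τ => ?_)
      change x.root (y.base.act (z.base.act τ)) * y.root (z.base.act τ) * z.root τ =
        x.root ((y.base * z.base).act τ) * (y.root (z.base.act τ) * z.root τ)
      rw [SU21.act_mul, mul_assoc])
    (fun x => by
      refine SqrtCover.ext (one_mul x.base) (ContinuousMap.ext fun τ => ?_)
      exact one_mul (x.root τ))
    (fun x => by
      refine SqrtCover.ext (inv_mul_cancel x.base) (ContinuousMap.ext fun τ => ?_)
      change (x.root (x.base⁻¹.act (x.base.act τ)))⁻¹ * x.root τ = 1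
      rw [← SU21.act_mul, inv_mul_cancel, SU21.act_one, inv_mul_cancel₀ (x.root_ne_zero τ)])

/-- The topology induced from `SU(2,1)(ℝ) × C(ℋ_ℂ, ℂ)`, where the space `C(ℋ_ℂ, ℂ)` of continuous
functions carries the compact-open topology. -/
noncomputable instance : TopologicalSpace SqrtCover :=
  TopologicalSpace.induced (fun x => (x.base, x.root)) inferInstance

/-- The projection `(g, φ) ↦ g`. -/
noncomputable def proj : SqrtCover →* SU21 where
  toFun x := x.base
  map_one' := rfl
  map_mul' _ _ := rfl

end SqrtCover

/-- A (two-sheeted) double cover of topological spaces: a covering map all of whose fibres have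
exactly two points. -/
structure IsDoubleCover {E X : Type*} [TopologicalSpace E] [TopologicalSpace X] (p : E → X) :
    Prop where
  isCoveringMap : IsCoveringMap p
  card_fiber : ∀ x : X, Nat.card (p ⁻¹' {x}) = 2

/-!
Topologically `SU(2,1)` is `ℋ_ℂ × S¹ × S³` (`SU21.decomposition`). It acts transitively on `ℋ_ℂ`:
the upper triangular elements `SU21.borel τ` map the base point `(-1, 0)` to `τ`, continuously
in `τ`. The stabilizer of the base point is `U(2)`; the automorphy factor at the base point is a
character of it with values in the circle, which is split as a map of spaces by diagonal matrices
(`SU21.torus`) and has the kernel `SU(2) = S³` (`SU21.unitary`). So `ℋ_ℂ × ℝ × S³` is a cover of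
`SU(2,1)` whose deck transformations are the translations of `ℝ` by multiples of `2π`.

Every covering of `SU(2,1)` is trivial over `ℋ_ℂ × ℝ × S³`: the sphere without a point is
contractible, and lifts over two such sets agree on their connected intersection
(`IsCoveringMap.exists_lift_of_union`). The generating deck transformation has to exchange the
sheets of a connected double cover, which is therefore the quotient of `ℋ_ℂ × ℝ × S³` by the
translation by `4π` (`IsDoubleCover.exists_quotient_lift`). This gives the uniqueness of the cover
as a space; unique lifting along `H × H` turns a homeomorphism that preserves the identity into an
isomorphism of groups (`IsDoubleCover.exists_continuousMulEquiv`).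

For the pairs `(g, φ)`, convexity of `ℋ_ℂ` implies that the quotient of `Cτ + D` by its value at the
base point never meets the negative real axis (`SU21.denom_div_mem_slitPlane`), so the principal
square root yields `φ` from its value at the base point, jointly continuously in `g` and `τ`.
A square root of the automorphy factor at the base point exists along `ℋ_ℂ × ℝ × S³` and involves
`exp (i t / 2)`, which changes sign under `t ↦ t + 2π`. Hence the connected space `ℋ_ℂ × ℝ × S³`
maps onto the space of pairs, and the projection `(g, φ) ↦ g` is a quotient map with the kernel
`{(1, 1), (1, -1)}`, that is, a covering. It has no section
by a homomorphism, since the involution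
`diag(-1, 1, -1)` has automorphy factor `-1` at its fixed point `(-1, 0)`, so that its lifts have
order four.
-/

/-! ### Lifting maps by gluing -/

/-- A map is lifted through a covering by gluing its lifts over two simply connected open sets:
the lifts agree at `a₀`, hence on the connected intersection. -/
theorem IsCoveringMap.exists_lift_of_union {A E X : Type*} [TopologicalSpace A]
    [TopologicalSpace E] [TopologicalSpace X] {p : E → X} (cov : IsCoveringMap p) {V W : Set A}
    (hV : IsOpen V) (hW : IsOpen W) [SimplyConnectedSpace V] [LocallyPathConnectedSpace V]
    [SimplyConnectedSpace W] [LocallyPathConnectedSpace W] (hVW : V ∪ W = Set.univ)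
    (hconn : IsPreconnected (V ∩ W)) (f : C(A, X)) {a₀ : A} (ha : a₀ ∈ V ∩ W) {e₀ : E}
    (he : p e₀ = f a₀) : ∃ F : C(A, E), F a₀ = e₀ ∧ p ∘ F = f := by
  obtain ⟨FV, ⟨hFV0, hFV⟩, -⟩ :=
    cov.existsUnique_continuousMap_lifts (f.restrict V) ⟨a₀, ha.1⟩ e₀ he
  obtain ⟨FW, ⟨hFW0, hFW⟩, -⟩ :=
    cov.existsUnique_continuousMap_lifts (f.restrict W) ⟨a₀, ha.2⟩ e₀ he
  have hV' (a : A) (h : a ∈ V) : p (FV ⟨a, h⟩) = f a := congrFun hFV ⟨a, h⟩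
  have hW' (a : A) (h : a ∈ W) : p (FW ⟨a, h⟩) = f a := congrFun hFW ⟨a, h⟩
  have : PreconnectedSpace ↥(V ∩ W) := isPreconnected_iff_preconnectedSpace.1 hconn
  have hagree : (fun a : ↥(V ∩ W) => FV ⟨a, a.2.1⟩) = fun a : ↥(V ∩ W) => FW ⟨a, a.2.2⟩ := by
    refine cov.eq_of_comp_eq (by fun_prop) (by fun_prop) (funext fun a => ?_) ⟨a₀, ha⟩ ?_
    · exact (hV' a a.2.1).trans (hW' a a.2.2).symm
    · exact hFV0.trans hFW0.symm
  have hVW' (a : A) (h₁ : a ∈ V) (h₂ : a ∈ W) : FV ⟨a, h₁⟩ = FW ⟨a, h₂⟩ :=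
    congrFun hagree ⟨a, h₁, h₂⟩
  let S : Bool → Set A := fun b => if b then V else W
  let φ : ∀ b, C(S b, E) := fun b => match b with
    | true => FV
    | false => FW
  have hφ : ∀ (i j) (x : A) (hxi : x ∈ S i) (hxj : x ∈ S j), φ i ⟨x, hxi⟩ = φ j ⟨x, hxj⟩ := by
    rintro (_ | _) (_ | _) x h₁ h₂
    · rfl
    · exact (hVW' x h₂ h₁).symm
    · exact hVW' x h₁ h₂
    · rfl
  have hS : ∀ x : A, ∃ i, S i ∈ nhds x := by
    intro x
    rcases (hVW ▸ Set.mem_univ x : x ∈ V ∪ W) with h | h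
    · exact ⟨true, hV.mem_nhds h⟩
    · exact ⟨false, hW.mem_nhds h⟩
  have hval (i) (x : S i) : ContinuousMap.liftCover S φ hφ hS x = φ i x :=
    ContinuousMap.liftCover_coe x
  refine ⟨ContinuousMap.liftCover S φ hφ hS, ?_, funext fun x => ?_⟩
  · exact (hval true ⟨a₀, ha.1⟩).trans hFV0
  · rcases (hVW ▸ Set.mem_univ x : x ∈ V ∪ W) with h | h
    · exact (congrArg p (hval true ⟨x, h⟩)).trans (hV' x h)
    · exact (congrArg p (hval false ⟨x, h⟩)).trans (hW' x h)

theorem IsLocalHomeomorph.isOpenMap_of_comp {U E X : Type*} [TopologicalSpace U]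
    [TopologicalSpace E] [TopologicalSpace X] {p : E → X} (hp : IsLocalHomeomorph p) {F : U → E}
    (hF : Continuous F) (h : IsOpenMap (p ∘ F)) : IsOpenMap F := by
  intro V hV
  rw [isOpen_iff_mem_nhds]
  rintro _ ⟨u, hu, rfl⟩
  obtain ⟨e, he, rfl⟩ := hp (F u)
  have hO : IsOpen (V ∩ F ⁻¹' e.source) := hV.inter (e.open_source.preimage hF)
  have h1 := e.isOpen_inter_preimage (h _ hO)
  refine Filter.mem_of_superset (h1.mem_nhds ⟨he, u, ⟨hu, he⟩, rfl⟩) ?_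
  rintro y ⟨hy, v, ⟨hv, hv'⟩, hvy⟩
  exact ⟨v, hv, e.injOn hv' hy hvy⟩

/-! ### Connected double covers of a quotient of a simply connected space -/

namespace IsDoubleCover

variable {U E X : Type*} [TopologicalSpace U] [TopologicalSpace E] [TopologicalSpace X]
  {p : E → X}

theorem eq_or_eq (hp : IsDoubleCover p) {a b c : E} (hab : a ≠ b) (h₁ : p b = p a)
    (h₂ : p c = p a) : c = a ∨ c = b := by
  by_contra! hc
  have hfin : Finite (p ⁻¹' {p a}) :=
    Nat.finite_of_card_ne_zero (by rw [hp.card_fiber]; norm_num)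
  have hcard : (p ⁻¹' {p a}).ncard = 2 := hp.card_fiber (p a)
  have h3 : ({c, a, b} : Set E).ncard = 3 := by
    rw [Set.ncard_eq_three]; exact ⟨c, a, b, hc.1, hc.2, hab, rfl⟩
  have hle := Set.ncard_le_ncard (s := {c, a, b}) (t := p ⁻¹' {p a})
    (by rintro x (rfl | rfl | rfl) <;> simp [h₁, h₂]) hfin
  omega

theorem exists_pair (hp : IsDoubleCover p) (x : X) : ∃ a b : E, a ≠ b ∧ p a = x ∧ p b = x := by
  have hcard : (p ⁻¹' {x}).ncard = 2 := hp.card_fiber x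
  obtain ⟨a, b, hab, h⟩ := Set.ncard_eq_two.1 hcard
  exact ⟨a, b, hab, (h ▸ Set.mem_insert a {b} : a ∈ p ⁻¹' {x}),
    (h ▸ Set.mem_insert_of_mem a rfl : b ∈ p ⁻¹' {x})⟩

/-- If the fibres of `q : U → X` are the orbits of a homeomorphism `T` of the connected space `U`
and `q` lifts through the connected double cover `p`, then a lift of `q` exhibits `E` as the
quotient of `U` by `T ^ 2`. Indeed, `T` must exchange the two sheets: otherwise the images of the
two lifts would be disjoint open sets covering `E`. -/
theorem exists_quotient_lift [ConnectedSpace E] (hp : IsDoubleCover p) [ConnectedSpace U]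
    {q : U → X} (hq : IsOpenQuotientMap q) (T : U ≃ₜ U) (hT : ∀ u, q (T u) = q u)
    (hfib : ∀ u v, q u = q v → ∃ n : ℤ, (T ^ n) u = v) (u₀ : U)
    (hlift : ∀ e₀ : E, p e₀ = q u₀ → ∃ F : C(U, E), F u₀ = e₀ ∧ p ∘ F = q) :
    ∃ F : U → E, IsOpenQuotientMap F ∧ p ∘ F = q ∧
      ∀ u v, F u = F v ↔ ∃ n : ℤ, (T ^ (2 * n)) u = v := by
  have cov := hp.isCoveringMap
  obtain ⟨a, b, hab, ha, hb⟩ := hp.exists_pair (q u₀)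
  obtain ⟨F, hF0, hF⟩ := hlift a ha
  obtain ⟨F', hF0', hF'⟩ := hlift b hb
  have hFp (u) : p (F u) = q u := congrFun hF u
  have hFp' (u) : p (F' u) = q u := congrFun hF' u
  have hopen (G : C(U, E)) (hG : p ∘ G = q) : IsOpenMap G :=
    cov.isLocalHomeomorph.isOpenMap_of_comp G.continuous (hG ▸ hq.isOpenMap)
  have hne (u) : F u ≠ F' u := fun h =>
    hab (hF0 ▸ hF0' ▸ congrFun (cov.eq_of_comp_eq F.continuous F'.continuous
      (hF.trans hF'.symm) u h) u₀)
  have hor (c : E) (u) (h : p c = q u) : c = F u ∨ c = F' u :=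
    hp.eq_or_eq (hne u) (by rw [hFp, hFp']) (by rw [hFp, h])
  have hTne (u) : F (T u) ≠ F u := by
    -- two lifts of `q` that agree at one point are equal, so `F` would be constant on fibres of `q`
    intro h
    have hall : F ∘ T = F := cov.eq_of_comp_eq (F.continuous.comp T.continuous) F.continuous
      (funext fun v => by simp [hFp, hT]) u h
    have hall1 (v) : F (T v) = F v := congrFun hall v
    have hpow (n : ℤ) : ∀ v, F ((T ^ n) v) = F v := by
      induction n using Int.induction_on with
      | zero => intro v; rfl
      | succ n ih => intro v; rw [_root_.zpow_add_one]; exact (ih (T v)).trans (hall1 v)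
      | pred n ih =>
        intro v; rw [_root_.zpow_sub_one]
        refine (ih (T⁻¹ v)).trans ?_
        rw [← hall1]; exact congrArg F (T.apply_symm_apply v)
    -- the images of the two lifts are open and cover the connected space `E`, so they meet
    have hcov : Set.range F ∪ Set.range F' = Set.univ := by
      refine Set.eq_univ_of_forall fun c => ?_
      obtain ⟨v, hv⟩ := hq.surjective (p c)
      rcases hor c v hv.symm with h | h
      · exact Or.inl ⟨v, h.symm⟩
      · exact Or.inr ⟨v, h.symm⟩
    obtain ⟨c, -, ⟨v, rfl⟩, w, hw⟩ := isPreconnected_univ (α := E) _ _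
      (hopen F hF).isOpen_range (hopen F' hF').isOpen_range hcov.ge
      ⟨a, trivial, u₀, hF0⟩ ⟨b, trivial, u₀, hF0'⟩
    obtain ⟨n, hn⟩ := hfib v w (by rw [← hFp, ← hw, hFp'])
    exact hne w (by rw [← hn, hpow, hn, hw])
  have hT' (u) : F' u = F (T u) :=
    ((hor (F (T u)) u (by rw [hFp, hT])).resolve_left (hTne u)).symm
  have hTT (u) : F (T (T u)) = F u := by
    rw [← hT']
    rcases hor (F' (T u)) u (by rw [hFp', hT]) with h | h
    · exact h
    · exact absurd ((hT' (T u)).symm.trans (h.trans (hT' u))) (hTne (T u))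
  have heven (n : ℤ) : ∀ v, F ((T ^ (2 * n)) v) = F v := by
    induction n using Int.induction_on with
    | zero => intro v; rfl
    | succ n ih =>
      intro v
      rw [mul_add, _root_.zpow_add]
      exact (ih _).trans (hTT v)
    | pred n ih =>
      intro v
      rw [mul_sub, _root_.zpow_sub]
      refine (ih _).trans ?_
      rw [← hTT]
      exact congrArg F ((T ^ 2).apply_symm_apply v)
  refine ⟨F, ⟨fun c => ?_, F.continuous, hopen F hF⟩, hF, fun u v => ⟨fun h => ?_, ?_⟩⟩
  · obtain ⟨v, hv⟩ := hq.surjective (p c)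
    rcases hor c v hv.symm with h | h
    · exact ⟨v, h.symm⟩
    · exact ⟨T v, by rw [h, hT']⟩
  · obtain ⟨n, hn⟩ := hfib u v (by rw [← hFp, h, hFp])
    rcases Int.even_or_odd' n with ⟨m, rfl | rfl⟩
    · exact ⟨m, hn⟩
    · refine absurd ?_ (hTne u)
      rw [h, ← hn, add_comm, _root_.zpow_add, zpow_one, ← heven m (T u), ← zpow_one T]
      exact congrArg F (DFunLike.congr_fun ((Commute.refl T).zpow_zpow (2 * m) 1).eq u)
  · rintro ⟨n, rfl⟩
    exact (heven n u).symm

end IsDoubleCover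

/-- Two quotient maps out of the same space with the same fibres have homeomorphic targets. -/
theorem Topology.IsQuotientMap.exists_homeomorph {U E E' : Type*} [TopologicalSpace U]
    [TopologicalSpace E] [TopologicalSpace E'] {F : U → E} {F' : U → E'}
    (hF : Topology.IsQuotientMap F) (hF' : Topology.IsQuotientMap F')
    (h : ∀ u v, F u = F v ↔ F' u = F' v) : ∃ e : E ≃ₜ E', ∀ u, e (F u) = F' u := by
  let s := Function.surjInv hF.surjective
  let s' := Function.surjInv hF'.surjective
  have hs (c) : F (s c) = c := Function.surjInv_eq hF.surjective c
  have hs' (c) : F' (s' c) = c := Function.surjInv_eq hF'.surjective c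
  have h1 (u) : F' (s (F u)) = F' u := (h _ _).1 (hs _)
  have h2 (u) : F (s' (F' u)) = F u := (h _ _).2 (hs' _)
  refine ⟨⟨⟨fun c => F' (s c), fun c => F (s' c), fun c => ?_, fun c => ?_⟩, ?_, ?_⟩, h1⟩
  · exact (h2 _).trans (hs c)
  · exact (h1 _).trans (hs' c)
  · exact hF.continuous_iff.2 (hF'.continuous.congr fun u => (h1 u).symm)
  · exact hF'.continuous_iff.2 (hF.continuous.congr fun u => (h2 u).symm)

/-! ### Lifting maps from the product of a contractible space and a sphere -/

open Metric in
/-- Stereographic projection: a product of a contractible space with the sphere is covered by two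
open sets, the complements of two antipodal points, to which `IsCoveringMap.exists_lift_of_union`
applies. -/
theorem IsCoveringMap.exists_lift_prod_sphere {B V E X : Type*} [TopologicalSpace B]
    [ContractibleSpace B] [LocallyPathConnectedSpace B] [NormedAddCommGroup V]
    [InnerProductSpace ℝ V] [FiniteDimensional ℝ V] (hV : 2 < Module.finrank ℝ V)
    [TopologicalSpace E] [TopologicalSpace X] {p : E → X} (cov : IsCoveringMap p)
    (f : C(B × sphere (0 : V) 1, X)) :
    ∃ u₀, ∀ e₀ : E, p e₀ = f u₀ → ∃ F : C(B × sphere (0 : V) 1, E), F u₀ = e₀ ∧ p ∘ F = f := by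
  have : Nontrivial V := Module.nontrivial_of_finrank_pos (R := ℝ) (by omega)
  obtain ⟨v, hv⟩ : ∃ v : V, ‖v‖ = 1 := exists_norm_eq V zero_le_one
  let N : sphere (0 : V) 1 := ⟨v, by simp [hv]⟩
  have hNN : -N ≠ N := fun h => by
    have h1 : -v = v := congrArg Subtype.val h
    have h2 : (2 : ℝ) • v = 0 := by
      rw [two_smul]
      nth_rewrite 1 [← h1]
      exact neg_add_cancel v
    have : v = 0 := (smul_eq_zero.1 h2).resolve_left two_ne_zero
    simp [this] at hv
  -- the sphere without a point is a Euclidean space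
  have chart (w : V) (hw : ‖w‖ = 1) :
      Nonempty (↥(Set.univ ×ˢ {(⟨w, by simp [hw]⟩ : sphere (0 : V) 1)}ᶜ :
        Set (B × sphere (0 : V) 1)) ≃ₜ B × (Submodule.span ℝ {w})ᗮ) := by
    let e := (stereographic hw).toHomeomorphSourceTarget
    exact ⟨(Homeomorph.Set.prod _ _).trans ((Homeomorph.Set.univ B).prodCongr
      (((Homeomorph.setCongr (stereographic_source hw)).symm.trans e).trans
        ((Homeomorph.setCongr (stereographic_target hw)).trans (Homeomorph.Set.univ _))))⟩
  obtain ⟨c₁⟩ := chart v hv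
  obtain ⟨c₂⟩ := chart (-v) (by simp [hv])
  have hneg : (⟨-v, by simp [hv]⟩ : sphere (0 : V) 1) = -N := rfl
  rw [hneg] at c₂
  have := c₁.contractibleSpace
  have := c₂.contractibleSpace
  have := c₁.isOpenEmbedding.locallyPathConnectedSpace
  have := c₂.isOpenEmbedding.locallyPathConnectedSpace
  -- the sphere without two antipodal points is a punctured Euclidean space
  have hconn : IsConnected ({N}ᶜ ∩ {-N}ᶜ : Set (sphere (0 : V) 1)) := by
    have : Fact (Module.finrank ℝ V = (Module.finrank ℝ V - 1) + 1) := ⟨by omega⟩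
    have hrank : 1 < Module.rank ℝ (Submodule.span ℝ {v})ᗮ := by
      rw [← Module.finrank_eq_rank, Submodule.finrank_orthogonal_span_singleton
        (n := Module.finrank ℝ V - 1) (by rintro rfl; simp at hv)]
      exact_mod_cast (by omega : 1 < Module.finrank ℝ V - 1)
    have h1 := isConnected_compl_singleton_of_one_lt_rank hrank 0
    have h2 : (stereographic hv).symm '' {0}ᶜ = ({N}ᶜ ∩ {-N}ᶜ : Set (sphere (0 : V) 1)) := by
      ext x
      constructor
      · rintro ⟨y, hy, rfl⟩
        have hy' : y ∈ (stereographic hv).target := by simp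
        have hs := (stereographic hv).map_target hy'
        rw [stereographic_source] at hs
        refine ⟨hs, fun h => hy ?_⟩
        have h' : (stereographic hv).symm y = -N := h
        have := (stereographic hv).right_inv hy'
        rw [h'] at this
        exact this.symm.trans (stereographic_apply_neg N)
      · rintro ⟨hx1, hx2⟩
        have hs : x ∈ (stereographic hv).source := by rw [stereographic_source]; exact hx1
        have hs' : -N ∈ (stereographic hv).source := by rw [stereographic_source]; exact hNN
        refine ⟨stereographic hv x, fun h => hx2 ?_, (stereographic hv).left_inv hs⟩
        exact (stereographic hv).injOn hs hs' (Eq.trans h (stereographic_apply_neg N).symm)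
    rw [← h2]
    refine h1.image _ ((stereographic hv).continuousOn_symm.mono ?_)
    simp
  obtain ⟨b⟩ : Nonempty B := inferInstance
  obtain ⟨x, hx⟩ := hconn.nonempty
  refine ⟨(b, x), fun e₀ he => cov.exists_lift_of_union
    (V := Set.univ ×ˢ {N}ᶜ) (W := Set.univ ×ˢ {-N}ᶜ)
    (isOpen_univ.prod isOpen_compl_singleton) (isOpen_univ.prod isOpen_compl_singleton)
    ?_ ?_ f ⟨⟨trivial, hx.1⟩, ⟨trivial, hx.2⟩⟩ he⟩
  · refine Set.eq_univ_of_forall fun y => ?_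
    by_cases h : y.2 = N
    · exact Or.inr ⟨trivial, fun h' => hNN (Eq.trans (Eq.symm h') h)⟩
    · exact Or.inl ⟨trivial, h⟩
  · rw [← Set.prod_inter]
    exact isPreconnected_univ.prod hconn.isPreconnected

/-! ### The decomposition of `SU(2,1)` -/

namespace SU21

theorem ext_entry {g h : SU21} (H : ∀ i j, g.entry i j = h.entry i j) : g = h :=
  Subtype.ext (Subtype.ext (Matrix.ext H))

theorem continuous_entry (i j : Fin 3) : Continuous fun g : SU21 => g.entry i j :=
  have h : Continuous fun g : SU21 => g.1.1 :=
    Continuous.comp (Y := SpecialLinearGroup (Fin 3) ℂ) continuous_induced_dom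
      continuous_induced_dom
  h.matrix_elem i j

theorem continuous_iff_entry {Y : Type*} [TopologicalSpace Y] {f : Y → SU21} :
    Continuous f ↔ ∀ i j, Continuous fun y => (f y).entry i j := by
  refine ⟨fun h i j => (continuous_entry i j).comp h, fun h => ?_⟩
  exact Continuous.subtype_mk (Continuous.subtype_mk (continuous_matrix h) _) _

section

variable {Y : Type*} [TopologicalSpace Y] {f : Y → SU21}

theorem continuous_denom_comp {h : Y → ℂ × ℂ} (hf : Continuous f) (hh : Continuous h) :
    Continuous fun y => (f y).denom (h y) := by
  have hc := continuous_iff_entry.1 hf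
  unfold denom
  fun_prop

theorem continuous_act_comp {h : Y → HC} (hf : Continuous f) (hh : Continuous h) :
    Continuous fun y => (f y).act (h y) := by
  have hc := continuous_iff_entry.1 hf
  have hd := continuous_denom_comp hf (continuous_subtype_val.comp hh)
  have hne : ∀ y, (f y).denom (h y) ≠ 0 := fun y => (f y).denom_ne_zero (h y).2
  unfold act
  refine Continuous.subtype_mk (Continuous.prodMk ?_ ?_) _
  · exact Continuous.div (by fun_prop) hd hne
  · exact Continuous.div (by fun_prop) hd hne

end

/-- The relations `⟨g eᵢ, g eⱼ⟩ = ⟨eᵢ, eⱼ⟩`. -/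
theorem form_entry (g : SU21) (i j : Fin 3) : g.entry 2 i * starRingEnd ℂ (g.entry 0 j) +
    g.entry 1 i * starRingEnd ℂ (g.entry 1 j) + g.entry 0 i * starRingEnd ℂ (g.entry 2 j) =
      formMatrix i j := by
  have hg : g.1.1ᵀ * formMatrix * g.1.1.map (starRingEnd ℂ) = formMatrix := g.2
  rw [← congrFun (congrFun hg i) j]
  simp [Matrix.mul_apply, Fin.sum_univ_three, formMatrix, entry]

/-- The base point `(-1, 0)` of `ℋ_ℂ`. -/
def basePoint : HC := ⟨(-1, 0), by simp [HC]⟩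

/-- The real number `r > 0` with `2 r² = -(N(τ₂) + Tr(τ₁))`. -/
noncomputable def height (τ : HC) : ℝ := √(-(Complex.normSq τ.1.2 / 2 + τ.1.1.re))

theorem height_sq (τ : HC) :
    height τ ^ 2 = -(Complex.normSq τ.1.2 / 2 + τ.1.1.re) := by
  have h : Complex.normSq τ.1.2 + 2 * τ.1.1.re < 0 := τ.2
  exact Real.sq_sqrt (by linarith)

theorem height_pos (τ : HC) : 0 < height τ := by
  have h : Complex.normSq τ.1.2 + 2 * τ.1.1.re < 0 := τ.2
  exact Real.sqrt_pos.2 (by linarith)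

theorem height_ne_zero (τ : HC) : (height τ : ℂ) ≠ 0 :=
  Complex.ofReal_ne_zero.2 (height_pos τ).ne'

theorem continuous_height : Continuous height := by
  unfold height
  have := Complex.continuous_normSq
  fun_prop

/-- The upper triangular element of `SU(2,1)` with positive diagonal which maps the base point
to `τ`. -/
noncomputable def borel (τ : HC) : SU21 :=
  ⟨⟨!![(height τ : ℂ), -starRingEnd ℂ τ.1.2,
        (-(τ.1.2 * starRingEnd ℂ τ.1.2) / 2 + τ.1.1.im * Complex.I) / height τ;
      0, 1, τ.1.2 / height τ;
      0, 0, (height τ : ℂ)⁻¹], by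
    have := height_ne_zero τ
    simp [Matrix.det_fin_three, this]⟩, by
    have := height_ne_zero τ
    have hc : starRingEnd ℂ 2 = 2 := Complex.conj_ofNat 2
    change _ * _ * _ = _
    ext i j
    fin_cases i <;> fin_cases j <;>
      simp [Matrix.mul_apply, Fin.sum_univ_three, formMatrix, this, hc] <;> field_simp <;> ring⟩

/-- The diagonal element of `SU(2,1)` with eigenvalues `ζ, ζ⁻², ζ`; it fixes the base point with
automorphy factor `ζ`. -/
noncomputable def torus (ζ : Circle) : SU21 :=
  ⟨⟨!![(ζ : ℂ), 0, 0; 0, (ζ : ℂ)⁻¹ ^ 2, 0; 0, 0, (ζ : ℂ)], by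
    have := ζ.coe_ne_zero
    simp [Matrix.det_fin_three]
    field_simp⟩, by
    have := ζ.coe_ne_zero
    have h : starRingEnd ℂ (ζ : ℂ) = (ζ : ℂ)⁻¹ := (Circle.coe_inv_eq_conj ζ).symm
    change _ * _ * _ = _
    ext i j
    fin_cases i <;> fin_cases j <;>
      simp [Matrix.mul_apply, Fin.sum_univ_three, formMatrix, h, this]⟩

/-- The unit sphere of `ℂ²`. -/
abbrev Sphere3 : Type := Metric.sphere (0 : WithLp 2 (ℂ × ℂ)) 1

theorem Sphere3.sq_add_sq (x : Sphere3) :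
    x.1.fst * starRingEnd ℂ x.1.fst + x.1.snd * starRingEnd ℂ x.1.snd = 1 := by
  have h : ‖x.1‖ = 1 := by simp
  have h2 := WithLp.prod_norm_sq_eq_of_L2 x.1
  rw [h] at h2
  rw [Complex.mul_conj, Complex.mul_conj, Complex.normSq_eq_norm_sq, Complex.normSq_eq_norm_sq]
  exact_mod_cast (h2.symm.trans (one_pow 2))

theorem sqrt_two_ne_zero : ((√2 : ℝ) : ℂ) ≠ 0 := by simp

theorem sqrt_two_sq : ((√2 : ℝ) : ℂ) ^ 2 = 2 := by
  exact_mod_cast Real.sq_sqrt (zero_le_two : (0 : ℝ) ≤ 2)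

/-- The stabilizer of the negative vector `(-1, 0, 1)` is the group `SU(2)` of its orthogonal
complement, spanned by the orthonormal vectors `(1, 0, 1) / √2` and `(0, 1, 0)`. This is its
element that maps `(0, 1, 0)` to `α (0, 1, 0) + β (1, 0, 1) / √2`, for `(α, β)` on the sphere. -/
noncomputable def unitary (x : Sphere3) : SU21 :=
  ⟨⟨!![(starRingEnd ℂ x.1.fst + 1) / 2, x.1.snd / (√2 : ℝ), (starRingEnd ℂ x.1.fst - 1) / 2;
      -starRingEnd ℂ x.1.snd / (√2 : ℝ), x.1.fst, -starRingEnd ℂ x.1.snd / (√2 : ℝ);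
      (starRingEnd ℂ x.1.fst - 1) / 2, x.1.snd / (√2 : ℝ), (starRingEnd ℂ x.1.fst + 1) / 2], by
    have h := x.sq_add_sq
    have h0 := sqrt_two_ne_zero
    have h2 := sqrt_two_sq
    simp [Matrix.det_fin_three]
    field_simp
    rw [h2]
    linear_combination 8 * h⟩, by
    have h := x.sq_add_sq
    have h0 := sqrt_two_ne_zero
    have h2 := sqrt_two_sq
    have hc : starRingEnd ℂ 2 = 2 := Complex.conj_ofNat 2
    change _ * _ * _ = _
    ext i j
    fin_cases i <;> fin_cases j <;>
      simp [Matrix.mul_apply, Fin.sum_univ_three, formMatrix, hc] <;> field_simp <;>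
      (try simp only [h2]) <;>
      first | ring1 | linear_combination 2 * h | linear_combination 4 * h⟩

theorem act_eq_iff (g : SU21) (τ σ : HC) : g.act τ = σ ↔
    g.coord τ 0 = σ.1.1 * g.denom τ ∧ g.coord τ 1 = σ.1.2 * g.denom τ := by
  have h0 := g.denom_ne_zero τ.2
  rw [← div_eq_iff h0, ← div_eq_iff h0, Subtype.ext_iff, Prod.ext_iff]
  rfl

theorem borel_act (τ : HC) : (borel τ).act basePoint = τ := by
  have h := height_ne_zero τ
  have h2 : ((height τ : ℂ)) ^ 2 = -(τ.1.2 * starRingEnd ℂ τ.1.2 / 2 + τ.1.1.re) := by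
    rw [Complex.mul_conj]
    exact_mod_cast congrArg Complex.ofReal (height_sq τ)
  refine (act_eq_iff _ _ _).2 ⟨?_, ?_⟩
  · simp only [coord, denom, entry, borel, basePoint]
    simp
    field_simp
    linear_combination -2 * h2 + 2 * Complex.re_add_im τ.1.1
  · simp [coord, denom, entry, borel, basePoint]
    field_simp

theorem borel_denom (τ : HC) : (borel τ).denom basePoint = (height τ : ℂ)⁻¹ := by
  simp [denom, entry, borel, basePoint]

theorem torus_act (ζ : Circle) : (torus ζ).act basePoint = basePoint := by
  refine (act_eq_iff _ _ _).2 ⟨?_, ?_⟩ <;> simp [coord, denom, entry, torus, basePoint]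

theorem torus_denom (ζ : Circle) : (torus ζ).denom basePoint = ζ := by
  simp [denom, entry, torus, basePoint]

theorem unitary_denom (x : Sphere3) : (unitary x).denom basePoint = 1 := by
  simp [denom, entry, unitary, basePoint]
  ring

theorem unitary_act (x : Sphere3) : (unitary x).act basePoint = basePoint := by
  refine (act_eq_iff _ _ _).2 ⟨?_, ?_⟩
  · rw [unitary_denom]
    simp [coord, entry, unitary, basePoint]
    ring
  · simp [coord, entry, unitary, basePoint]

theorem continuous_borel : Continuous borel := by
  have h := height_ne_zero
  have hc := continuous_height
  refine continuous_iff_entry.2 fun i j => ?_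
  have hd : Continuous fun τ : HC => (height τ : ℂ) := by fun_prop
  have hinv : Continuous fun τ : HC => (height τ : ℂ)⁻¹ := hd.inv₀ h
  fin_cases i <;> fin_cases j <;> simp [entry, borel, div_eq_mul_inv] <;> fun_prop

theorem continuous_torus : Continuous torus := by
  refine continuous_iff_entry.2 fun i j => ?_
  have hd : Continuous fun ζ : Circle => (ζ : ℂ) := by fun_prop
  have hinv : Continuous fun ζ : Circle => (ζ : ℂ)⁻¹ := hd.inv₀ fun ζ => ζ.coe_ne_zero
  fin_cases i <;> fin_cases j <;> simp [entry, torus, -inv_pow] <;> fun_prop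

theorem continuous_unitary : Continuous unitary := by
  refine continuous_iff_entry.2 fun i j => ?_
  have h1 : Continuous fun x : Sphere3 => x.1.fst := by fun_prop
  have h2 : Continuous fun x : Sphere3 => x.1.snd := by fun_prop
  fin_cases i <;> fin_cases j <;> simp [entry, unitary] <;> fun_prop

theorem normSq_denom_of_act_eq {h : SU21} (hh : h.act basePoint = basePoint) :
    Complex.normSq (h.denom basePoint) = 1 := by
  obtain ⟨h0, h1⟩ := (act_eq_iff _ _ _).1 hh
  have hf := h.form_coord basePoint
  have h2 : h.coord basePoint 2 = h.denom basePoint := rfl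
  rw [h0, h1, h2] at hf
  simp [basePoint] at hf ⊢
  rw [Complex.normSq_apply]
  linarith

/-- An element with `g (-1, 0, 1) = (-1, 0, 1)` is determined by its middle column `(b, a, b)`. -/
theorem entry_of_stabilizer {k : SU21} (hk : k.act basePoint = basePoint)
    (hd : k.denom basePoint = 1) :
    (k.entry 1 1 * starRingEnd ℂ (k.entry 1 1) +
      2 * (k.entry 0 1 * starRingEnd ℂ (k.entry 0 1)) = 1) ∧
    k.entry 2 1 = k.entry 0 1 ∧
    k.entry 1 0 = -starRingEnd ℂ (k.entry 0 1) ∧ k.entry 1 2 = -starRingEnd ℂ (k.entry 0 1) ∧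
    k.entry 0 0 = (starRingEnd ℂ (k.entry 1 1) + 1) / 2 ∧
    k.entry 2 2 = (starRingEnd ℂ (k.entry 1 1) + 1) / 2 ∧
    k.entry 0 2 = (starRingEnd ℂ (k.entry 1 1) - 1) / 2 ∧
    k.entry 2 0 = (starRingEnd ℂ (k.entry 1 1) - 1) / 2 := by
  obtain ⟨h0, h1⟩ := (act_eq_iff _ _ _).1 hk
  rw [hd] at h0 h1
  simp [coord, denom, basePoint] at h0 h1 hd
  have hdet : k.1.1.det = 1 := k.1.2
  rw [Matrix.det_fin_three] at hdet
  change k.entry 0 0 * k.entry 1 1 * k.entry 2 2 - k.entry 0 0 * k.entry 1 2 * k.entry 2 1 -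
    k.entry 0 1 * k.entry 1 0 * k.entry 2 2 + k.entry 0 1 * k.entry 1 2 * k.entry 2 0 +
    k.entry 0 2 * k.entry 1 0 * k.entry 2 1 - k.entry 0 2 * k.entry 1 1 * k.entry 2 0 = 1 at hdet
  have e02 : k.entry 0 2 = k.entry 0 0 - 1 := by linear_combination h0
  have e12 : k.entry 1 2 = k.entry 1 0 := by linear_combination h1
  have e22 : k.entry 2 2 = k.entry 2 0 + 1 := by linear_combination hd
  have c02 := congrArg (starRingEnd ℂ) e02
  have c12 := congrArg (starRingEnd ℂ) e12
  have c22 := congrArg (starRingEnd ℂ) e22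
  simp only [map_sub, map_add, map_one] at c02 c12 c22
  -- the form pairs every column with `(-1, 0, 1)` as it pairs the basis vectors
  have row (i : Fin 3) : k.entry 0 i - k.entry 2 i = formMatrix i 2 - formMatrix i 0 := by
    rw [← form_entry k i 2, ← form_entry k i 0, c02, c12, c22]
    ring
  have r0 := row 0
  have r1 := row 1
  simp [formMatrix] at r0 r1
  have e21 : k.entry 2 1 = k.entry 0 1 := by linear_combination -r1
  have e20 : k.entry 2 0 = k.entry 0 0 - 1 := by linear_combination -r0
  have f11 := form_entry k 1 1
  have f01 := form_entry k 0 1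
  simp [formMatrix] at f11 f01
  rw [e21] at f11 f01
  rw [e20] at f01 e22
  rw [e02, e12, e22, e21, e20] at hdet
  set a := k.entry 1 1
  set b := k.entry 0 1
  set p := k.entry 0 0
  set c := k.entry 1 0
  have hN : a * starRingEnd ℂ a + 2 * (b * starRingEnd ℂ b) = 1 := by linear_combination f11
  -- Cramer's rule: the linear equations `hdet`, `f01` in `2 p - 1`, `c` have the determinant
  -- `a ā + 2 b b̄ = 1`
  have hp : p = (starRingEnd ℂ a + 1) / 2 := by
    linear_combination (starRingEnd ℂ a / 2) * hdet + b * f01 - (2 * p - 1) / 2 * hN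
  have hc : c = -starRingEnd ℂ b := by
    linear_combination a * f01 - starRingEnd ℂ b * hdet - c * hN
  refine ⟨hN, e21, hc, e12.trans hc, hp, ?_, ?_, ?_⟩
  · rw [e22, hp]; ring
  · rw [e02, hp]; ring
  · rw [e20, hp]; ring

/-- The product of the factors of the decomposition `g = b t k` of `SU(2,1)`: `b` moves the base
point, `t` is the argument of the automorphy factor at the base point, `k` lies in `SU(2)`. -/
noncomputable def assemble (y : (HC × Circle) × Sphere3) : SU21 :=
  borel y.1.1 * (torus y.1.2 * unitary y.2)

theorem continuous_assemble : Continuous assemble :=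
  (continuous_borel.comp (by fun_prop)).mul
    ((continuous_torus.comp (by fun_prop)).mul (continuous_unitary.comp (by fun_prop)))

theorem assemble_act (y) : (assemble y).act basePoint = y.1.1 := by
  rw [assemble, act_mul, act_mul, unitary_act, torus_act, borel_act]

theorem assemble_denom (y) :
    (assemble y).denom basePoint = (height y.1.1 : ℂ)⁻¹ * (y.1.2 : ℂ) := by
  rw [assemble, denom_mul, denom_mul, act_mul, unitary_act, torus_act, borel_denom, torus_denom,
    unitary_denom, mul_one]

/-- The component `b⁻¹ g = t k` of `g = b t k` in the stabilizer of the base point. -/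
noncomputable def stabPart (g : SU21) : SU21 := (borel (g.act basePoint))⁻¹ * g

theorem borel_mul_stabPart (g : SU21) : borel (g.act basePoint) * stabPart g = g :=
  mul_inv_cancel_left _ _

theorem stabPart_act (g : SU21) : (stabPart g).act basePoint = basePoint := by
  rw [stabPart, act_mul]
  nth_rewrite 2 [← borel_act (g.act basePoint)]
  rw [← act_mul, inv_mul_cancel, act_one]

theorem continuous_stabPart : Continuous stabPart := by
  have h' : Continuous fun g : SU21 => (borel (g.act basePoint))⁻¹ := 
    (continuous_borel.comp (continuous_act_comp continuous_id continuous_const)).inv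
  unfold stabPart
  exact h'.mul continuous_id

/-- The circle component of `g = b t k`. -/
noncomputable def circlePart (g : SU21) : Circle :=
  ⟨(stabPart g).denom basePoint, by
    have h := normSq_denom_of_act_eq (stabPart_act g)
    rw [Complex.normSq_eq_norm_sq, pow_eq_one_iff_of_nonneg (norm_nonneg _) two_ne_zero] at h
    exact mem_sphere_zero_iff_norm.2 h⟩

theorem continuous_circlePart : Continuous circlePart :=
  Continuous.subtype_mk (continuous_denom_comp continuous_stabPart continuous_const) _

/-- The component in `SU(2)` of `g = b t k`. -/
noncomputable def unitaryPart (g : SU21) : SU21 := (torus (circlePart g))⁻¹ * stabPart g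

theorem torus_mul_unitaryPart (g : SU21) : torus (circlePart g) * unitaryPart g = stabPart g :=
  mul_inv_cancel_left _ _

theorem unitaryPart_act (g : SU21) : (unitaryPart g).act basePoint = basePoint := by
  rw [unitaryPart, act_mul, stabPart_act]
  nth_rewrite 1 [← torus_act (circlePart g)]
  rw [← act_mul, inv_mul_cancel, act_one]

theorem unitaryPart_denom (g : SU21) : (unitaryPart g).denom basePoint = 1 := by
  have h := denom_mul (torus (circlePart g)) (unitaryPart g) basePoint
  rw [torus_mul_unitaryPart, unitaryPart_act, torus_denom] at h
  exact mul_left_cancel₀ (circlePart g).coe_ne_zero (h.symm.trans (mul_one _).symm)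

theorem continuous_unitaryPart : Continuous unitaryPart :=
  (continuous_torus.comp continuous_circlePart).inv.mul continuous_stabPart

/-- The point of the sphere that parametrizes the component in `SU(2)` of `g = b t k`. -/
noncomputable def spherePart (g : SU21) : Sphere3 :=
  ⟨WithLp.toLp 2 ((unitaryPart g).entry 1 1, (√2 : ℝ) * (unitaryPart g).entry 0 1), by
    obtain ⟨h, -⟩ := entry_of_stabilizer (unitaryPart_act g) (unitaryPart_denom g)
    rw [Complex.mul_conj, Complex.mul_conj, Complex.normSq_eq_norm_sq,
      Complex.normSq_eq_norm_sq] at h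
    have h' : ‖(unitaryPart g).entry 1 1‖ ^ 2 + 2 * ‖(unitaryPart g).entry 0 1‖ ^ 2 = 1 := by
      exact_mod_cast h
    rw [mem_sphere_zero_iff_norm, ← sq_eq_sq₀ (norm_nonneg _) zero_le_one,
      WithLp.prod_norm_sq_eq_of_L2]
    simp [mul_pow, h']⟩

theorem continuous_spherePart : Continuous spherePart := by
  have h (i j : Fin 3) : Continuous fun g => (unitaryPart g).entry i j :=
    (continuous_entry i j).comp continuous_unitaryPart
  refine Continuous.subtype_mk ?_ _
  exact (WithLp.prod_continuous_toLp 2 ℂ ℂ).comp ((h 1 1).prodMk (continuous_const.mul (h 0 1)))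

theorem unitary_spherePart (g : SU21) : unitary (spherePart g) = unitaryPart g := by
  obtain ⟨-, h21, h10, h12, h00, h22, h02, h20⟩ :=
    entry_of_stabilizer (unitaryPart_act g) (unitaryPart_denom g)
  have h0 := sqrt_two_ne_zero
  refine ext_entry fun i j => ?_
  fin_cases i <;> fin_cases j <;> simp only [Fin.mk_zero, Fin.mk_one, Fin.isValue,
    Fin.reduceFinMk, h21, h10, h12, h00, h22, h02, h20] <;>
    simp [entry, unitary, spherePart, h0] <;> field_simp

/-- The homeomorphism `SU(2,1) ≃ ℋ_ℂ × S¹ × S³`. -/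
noncomputable def decomposition : (HC × Circle) × Sphere3 ≃ₜ SU21 where
  toFun := assemble
  invFun g := ((g.act basePoint, circlePart g), spherePart g)
  left_inv y := by
    have h1 := assemble_act y
    have h2 : stabPart (assemble y) = torus y.1.2 * unitary y.2 := by
      rw [stabPart, h1, assemble, inv_mul_cancel_left]
    have h3 : circlePart (assemble y) = y.1.2 := by
      apply Circle.ext
      change (stabPart (assemble y)).denom basePoint = _
      rw [h2, denom_mul, unitary_act, torus_denom, unitary_denom, mul_one]
    have h4 : unitaryPart (assemble y) = unitary y.2 := by
      rw [unitaryPart, h2, h3, inv_mul_cancel_left]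
    refine Prod.ext (Prod.ext h1 h3) (Subtype.ext ?_)
    change WithLp.toLp 2 ((unitaryPart (assemble y)).entry 1 1,
      ((√2 : ℝ) : ℂ) * (unitaryPart (assemble y)).entry 0 1) = y.2.1
    rw [h4]
    have h0 := sqrt_two_ne_zero
    simp only [entry, unitary]
    simp
    rw [mul_div_cancel₀ _ h0]
    rfl
  right_inv g := by
    change borel _ * (torus _ * unitary _) = g
    rw [unitary_spherePart, torus_mul_unitaryPart, borel_mul_stabPart]
  continuous_toFun := continuous_assemble
  continuous_invFun :=
    ((continuous_act_comp continuous_id continuous_const).prodMk continuous_circlePart).prodMk continuous_spherePart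

/-! ### The simply connected cover and the classification of double covers -/

/-- The simply connected cover `ℋ_ℂ × ℝ × S³` of `SU(2,1)`. -/
noncomputable def univCover (u : (HC × ℝ) × Sphere3) : SU21 :=
  assemble ((u.1.1, Circle.exp u.1.2), u.2)

theorem isOpenQuotientMap_circleExp : IsOpenQuotientMap Circle.exp :=
  ⟨Circle.exp_surjective, Circle.exp.continuous, isLocalHomeomorph_circleExp.isOpenMap⟩

theorem isOpenQuotientMap_univCover : IsOpenQuotientMap univCover :=
  decomposition.isOpenQuotientMap.comp
    ((IsOpenQuotientMap.id.prodMap isOpenQuotientMap_circleExp).prodMap IsOpenQuotientMap.id)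

/-- The translation by `2π` on the factor `ℝ`, which generates the deck transformations. -/
noncomputable def deck : (HC × ℝ) × Sphere3 ≃ₜ (HC × ℝ) × Sphere3 :=
  ((Homeomorph.refl HC).prodCongr (Homeomorph.addRight (2 * Real.pi))).prodCongr
    (Homeomorph.refl Sphere3)

theorem univCover_deck (u) : univCover (deck u) = univCover u := by
  change assemble ((u.1.1, Circle.exp (u.1.2 + 2 * Real.pi)), u.2) = _
  rw [Circle.periodic_exp u.1.2]
  rfl

theorem deck_zpow (n : ℤ) : ∀ u, (deck ^ n) u = ((u.1.1, u.1.2 + n * (2 * Real.pi)), u.2) := by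
  induction n using Int.induction_on with
  | zero => intro u; simp
  | succ n ih =>
    intro u
    rw [_root_.zpow_add_one]
    refine (ih _).trans ?_
    simp [deck]
    ring
  | pred n ih =>
    intro u
    rw [_root_.zpow_sub_one]
    refine (ih _).trans ?_
    change ((u.1.1, u.1.2 + -(2 * Real.pi) + _), u.2) = _
    simp
    ring

theorem exists_deck_zpow {u v} (h : univCover u = univCover v) :
    ∃ n : ℤ, (deck ^ n) u = v := by
  have h1 := decomposition.injective h
  simp only [Prod.mk.injEq] at h1
  obtain ⟨⟨h1, h2⟩, h3⟩ := h1
  obtain ⟨n, hn⟩ := Circle.exp_eq_exp.1 h2.symm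
  refine ⟨n, ?_⟩
  rw [deck_zpow]
  exact Prod.ext (Prod.ext h1 hn.symm) h3

theorem convex_HC : Convex ℝ HC := by
  intro x hx y hy a b ha hb hab
  simp only [HC, Set.mem_ofPred_eq, Complex.normSq_apply] at hx hy ⊢
  simp
  obtain rfl : b = 1 - a := by linarith
  have h1 := mul_nonneg (mul_nonneg ha hb)
    (add_nonneg (sq_nonneg (x.2.re - y.2.re)) (sq_nonneg (x.2.im - y.2.im)))
  rcases ha.eq_or_lt with rfl | ha'
  · simpa using hy
  · nlinarith [mul_neg_of_pos_of_neg ha' hx, mul_nonpos_of_nonneg_of_nonpos hb hy.le]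

instance : ContractibleSpace HC := convex_HC.contractibleSpace ⟨_, basePoint.2⟩

instance : LocallyPathConnectedSpace HC := convex_HC.locallyPathConnectedSpace

theorem finrank_withLp_prod_complex : Module.finrank ℝ (WithLp 2 (ℂ × ℂ)) = 4 := by
  rw [(WithLp.linearEquiv 2 ℝ (ℂ × ℂ)).finrank_eq]; simp

instance : ConnectedSpace Sphere3 := by
  refine isConnected_iff_connectedSpace.1 (isConnected_sphere ?_ _ zero_le_one)
  rw [← Module.finrank_eq_rank, finrank_withLp_prod_complex]
  norm_num

/-- A connected double cover of `SU(2,1)` is the quotient of `ℋ_ℂ × ℝ × S³` by the translation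
by `4π` on `ℝ`. -/
theorem exists_univCover_lift {E : Type*} [TopologicalSpace E] [ConnectedSpace E] {p : E → SU21}
    (hp : IsDoubleCover p) : ∃ F : (HC × ℝ) × Sphere3 → E, IsOpenQuotientMap F ∧
      p ∘ F = univCover ∧ ∀ u v, F u = F v ↔ ∃ n : ℤ, (deck ^ (2 * n)) u = v := by
  obtain ⟨u₀, hu₀⟩ := hp.isCoveringMap.exists_lift_prod_sphere (by rw [finrank_withLp_prod_complex]; norm_num)
    (⟨univCover, isOpenQuotientMap_univCover.continuous⟩ : C((HC × ℝ) × Sphere3, SU21))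
  exact hp.exists_quotient_lift isOpenQuotientMap_univCover deck univCover_deck
    (fun u v => exists_deck_zpow) u₀ hu₀

end SU21

/-- Two connected double covers of `SU(2,1)` are isomorphic. -/
theorem IsDoubleCover.exists_homeomorph {E E' : Type*} [TopologicalSpace E] [ConnectedSpace E]
    [TopologicalSpace E'] [ConnectedSpace E'] {p : E → SU21} {p' : E' → SU21}
    (hp : IsDoubleCover p) (hp' : IsDoubleCover p') : ∃ e : E ≃ₜ E', ∀ x, p' (e x) = p x := by
  obtain ⟨F, hF, hpF, h⟩ := SU21.exists_univCover_lift hp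
  obtain ⟨F', hF', hpF', h'⟩ := SU21.exists_univCover_lift hp'
  obtain ⟨e, he⟩ := hF.isQuotientMap.exists_homeomorph hF'.isQuotientMap
    fun u v => (h u v).trans (h' u v).symm
  refine ⟨e, fun x => ?_⟩
  obtain ⟨u, rfl⟩ := hF.surjective x
  rw [he]
  exact (congrFun hpF' u).trans (congrFun hpF u).symm

/-! ### The group of pairs `(g, φ)` -/

namespace SU21

/-- The points `Cτ + D`, for `τ` in the convex set `ℋ_ℂ`, form a convex set that does not
contain `0`; after division by the value at the base point it contains `1`, hence it avoids the
negative real axis. -/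
theorem denom_div_mem_slitPlane (g : SU21) (τ : HC) :
    g.denom τ / g.denom basePoint ∈ Complex.slitPlane := by
  have h0 := g.denom_ne_zero basePoint.2
  by_contra h
  rw [Complex.mem_slitPlane_iff_not_le_zero, not_not] at h
  obtain ⟨hre, him⟩ := Complex.le_def.1 h
  have hz : g.denom τ / g.denom basePoint = ((g.denom τ / g.denom basePoint).re : ℂ) :=
    Complex.ext rfl him
  set x : ℝ := (g.denom τ / g.denom basePoint).re
  have hx : x ≤ 0 := hre
  have hd : g.denom τ = x * g.denom basePoint := (div_eq_iff h0).1 hz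
  -- the point of the segment from the base point to `τ` at which the affine function vanishes
  have hx1 : 1 - x ≠ 0 := by linarith
  have hmem := convex_HC τ.2 basePoint.2 (a := 1 / (1 - x)) (b := -x / (1 - x))
    (div_nonneg zero_le_one (by linarith)) (div_nonneg (by linarith) (by linarith))
    (by field_simp; ring)
  refine g.denom_ne_zero hmem ?_
  have hx2 : (1 - x : ℂ) ≠ 0 := by exact_mod_cast hx1
  have e : g.denom ((1 / (1 - x)) • τ.1 + (-x / (1 - x)) • basePoint.1) =
      (g.denom τ - x * g.denom basePoint) / (1 - x) := by
    simp [denom]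
    field_simp
    ring
  rw [e, hd, sub_self, zero_div]

/-- The continuous square root of `(Cτ + D) / (Cτ₀ + D)` with the value `1` at the base point
`τ₀`. -/
noncomputable def branch (g : SU21) (τ : HC) : ℂ :=
  (g.denom τ / g.denom basePoint) ^ (1 / 2 : ℂ)

theorem branch_sq (g : SU21) (τ : HC) :
    g.branch τ ^ 2 = g.denom τ / g.denom basePoint := by
  rw [branch, ← Complex.cpow_nat_mul]
  norm_num

theorem continuous_branch_comp {Y : Type*} [TopologicalSpace Y] {f : Y → SU21} {h : Y → HC}
    (hf : Continuous f) (hh : Continuous h) : Continuous fun y => (f y).branch (h y) := by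
  unfold branch
  exact ((continuous_denom_comp hf (continuous_subtype_val.comp hh)).div
    (continuous_denom_comp hf continuous_const)
      fun y => (f y).denom_ne_zero basePoint.2).cpow continuous_const
    fun y => denom_div_mem_slitPlane (f y) (h y)

/-- A continuous square root of the automorphy factor at the base point along the simply connected
cover of `SU(2,1)`. -/
noncomputable def baseRoot (u : (HC × ℝ) × Sphere3) : ℂ :=
  ((√(height u.1.1)⁻¹ : ℝ) : ℂ) * Complex.exp ((u.1.2 / 2 : ℝ) * Complex.I)

theorem baseRoot_sq (u) : baseRoot u ^ 2 = (univCover u).denom basePoint := by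
  rw [univCover, assemble_denom, baseRoot, mul_pow, ← Complex.exp_nat_mul, ← Complex.ofReal_pow,
    Real.sq_sqrt (inv_nonneg.2 (height_pos _).le), Circle.coe_exp, Complex.ofReal_inv]
  congr 2
  push_cast
  ring

theorem continuous_baseRoot : Continuous baseRoot := by
  have h : Continuous fun u : (HC × ℝ) × Sphere3 => (height u.1.1)⁻¹ :=
    (continuous_height.comp (by fun_prop)).inv₀ fun u => (height_pos u.1.1).ne'
  unfold baseRoot
  fun_prop

theorem baseRoot_deck (u) : baseRoot (deck u) = -baseRoot u := by
  change ((√(height u.1.1)⁻¹ : ℝ) : ℂ) *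
    Complex.exp (((u.1.2 + 2 * Real.pi) / 2 : ℝ) * Complex.I) = _
  have e : (((u.1.2 + 2 * Real.pi) / 2 : ℝ) : ℂ) * Complex.I =
      ((u.1.2 / 2 : ℝ) : ℂ) * Complex.I + Real.pi * Complex.I := by
    push_cast
    ring
  rw [e, Complex.exp_add, Complex.exp_pi_mul_I, baseRoot]
  ring

end SU21

instance : LocallyCompactSpace HC := by
  refine IsOpen.locallyCompactSpace (isOpen_lt ?_ continuous_const)
  have := Complex.continuous_normSq
  fun_prop

namespace SqrtCover

open SU21

theorem continuous_base_prodMk_root : Continuous fun x : SqrtCover => (x.base, x.root) :=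
  continuous_induced_dom

theorem continuous_base : Continuous base := continuous_base_prodMk_root.fst

theorem continuous_root : Continuous root := continuous_base_prodMk_root.snd

theorem continuous_root_comp {Y : Type*} [TopologicalSpace Y] {f : Y → SqrtCover} {h : Y → HC}
    (hf : Continuous f) (hh : Continuous h) : Continuous fun y => (f y).root (h y) :=
  (continuous_root.comp hf).eval hh

/-- As `ℋ_ℂ` is locally compact, continuity of a family of pairs `(g, φ)` may be tested on
`φ(τ)` as a function of all variables. -/
theorem continuous_of {Y : Type*} [TopologicalSpace Y] {f : Y → SqrtCover}
    (h₁ : Continuous fun y => (f y).base)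
    (h₂ : Continuous fun x : Y × HC => (f x.1).root x.2) : Continuous f :=
  continuous_induced_rng.2
    (h₁.prodMk (ContinuousMap.continuous_of_continuous_uncurry _ h₂))

instance : IsTopologicalGroup SqrtCover where
  continuous_mul := by
    have h₁ : Continuous fun x : (SqrtCover × SqrtCover) × HC => x.1.1 := by fun_prop
    have h₂ : Continuous fun x : (SqrtCover × SqrtCover) × HC => x.1.2 := by fun_prop
    refine continuous_of ((continuous_base.comp continuous_fst).mul
      (continuous_base.comp continuous_snd)) ?_
    have hr := (continuous_root_comp h₁ (continuous_act_comp (continuous_base.comp h₂)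
      continuous_snd)).mul (continuous_root_comp h₂ continuous_snd)
    exact hr
  continuous_inv := by
    have hi : Continuous fun x : SqrtCover => x.base⁻¹ := continuous_base.inv
    refine continuous_of hi (Continuous.inv₀ ?_ fun x => x.1.root_ne_zero _)
    exact continuous_root_comp continuous_fst
      (continuous_act_comp (hi.comp continuous_fst) continuous_snd)

instance : T2Space SqrtCover :=
  T2Space.of_injective_continuous (f := fun x : SqrtCover => (x.base, x.root))
    (fun _ _ h => SqrtCover.ext (congrArg Prod.fst h) (congrArg Prod.snd h))
    continuous_base_prodMk_root

theorem continuous_proj : Continuous proj := continuous_base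

/-- The other point `(g, -φ)` of the fibre of `(g, φ)`. -/
noncomputable instance : Neg SqrtCover where
  neg x := ⟨x.base, -x.root, fun τ => by simp [x.root_sq τ]⟩

theorem ne_neg (x : SqrtCover) : x ≠ -x := fun h => by
  have h1 : x.root basePoint = -x.root basePoint := congrArg (fun y => y.root basePoint) h
  exact x.root_ne_zero basePoint (self_eq_neg.1 h1)

theorem eq_or_eq_neg {x y : SqrtCover} (h : x.base = y.base) : x = y ∨ x = -y := by
  have hsq : Set.EqOn ((x.root : HC → ℂ) ^ 2) ((y.root : HC → ℂ) ^ 2) Set.univ := fun τ _ => by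
    simp only [Pi.pow_apply, x.root_sq, y.root_sq, h]
  rcases isPreconnected_univ.eq_or_eq_neg_of_sq_eq x.root.continuous.continuousOn
    y.root.continuous.continuousOn hsq (fun {τ} _ => y.root_ne_zero τ) with h' | h'
  · exact Or.inl (SqrtCover.ext h (ContinuousMap.ext fun τ => h' trivial))
  · exact Or.inr (SqrtCover.ext h (ContinuousMap.ext fun τ => h' trivial))

theorem proj_fiber (x : SqrtCover) : proj ⁻¹' {proj x} = {x, -x} := by
  ext y
  refine ⟨fun h => eq_or_eq_neg h, ?_⟩
  rintro (rfl | rfl) <;> rfl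

/-- The lift of the simply connected cover of `SU(2,1)` to the pairs `(g, φ)`. -/
noncomputable def ofUnivCover (u : (HC × ℝ) × Sphere3) : SqrtCover where
  base := univCover u
  root := ⟨fun τ => baseRoot u * (univCover u).branch τ, continuous_const.mul
    (continuous_branch_comp continuous_const continuous_id)⟩
  root_sq τ := by
    have h0 := (univCover u).denom_ne_zero basePoint.2
    simp only [ContinuousMap.coe_mk, mul_pow, branch_sq, baseRoot_sq]
    rw [mul_div_cancel₀ _ h0]

theorem continuous_ofUnivCover : Continuous ofUnivCover := by
  have h := isOpenQuotientMap_univCover.continuous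
  refine continuous_of h ?_
  exact (continuous_baseRoot.comp continuous_fst).mul
    (continuous_branch_comp (h.comp continuous_fst) continuous_snd)

theorem ofUnivCover_deck (u) : ofUnivCover (deck u) = -ofUnivCover u := by
  refine SqrtCover.ext (univCover_deck u) (ContinuousMap.ext fun τ => ?_)
  change baseRoot (deck u) * (univCover (deck u)).branch τ =
    -(baseRoot u * (univCover u).branch τ)
  rw [univCover_deck, baseRoot_deck, neg_mul]

theorem surjective_ofUnivCover : Function.Surjective ofUnivCover := fun x => by
  obtain ⟨u, hu⟩ := isOpenQuotientMap_univCover.surjective x.base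
  rcases eq_or_eq_neg (x := x) (y := ofUnivCover u) hu.symm with h | h
  · exact ⟨u, h.symm⟩
  · exact ⟨deck u, by rw [ofUnivCover_deck, h]⟩

instance : ConnectedSpace SqrtCover :=
  surjective_ofUnivCover.connectedSpace continuous_ofUnivCover

theorem isDoubleCover_proj : IsDoubleCover proj where
  isCoveringMap := by
    have hq : Topology.IsQuotientMap proj :=
      .of_comp continuous_ofUnivCover continuous_proj isOpenQuotientMap_univCover.isQuotientMap
    have hfin : (proj.ker : Set SqrtCover).Finite := by
      have h : (proj.ker : Set SqrtCover) = {1, -1} := proj_fiber 1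
      rw [h]
      exact Set.toFinite _
    exact (hq.isQuotientCoveringMap_of_isDiscrete_ker_monoidHom hfin.isDiscrete).isCoveringMap
  card_fiber g := by
    obtain ⟨u, rfl⟩ := isOpenQuotientMap_univCover.surjective g
    have h : (proj ⁻¹' {proj (ofUnivCover u)}).ncard = 2 := by
      rw [proj_fiber, Set.ncard_pair (ne_neg _)]
    exact h

/-- The element `diag(-1, 1, -1)` of order two fixes the base point with automorphy factor `-1`,
so the square of a lift is `(1, -1)`. -/
theorem not_exists_section :
    ¬ ∃ s : SU21 →* SqrtCover, ∀ g : SU21, proj (s g) = g := by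
  rintro ⟨s, hs⟩
  have hg : torus (-1) * torus (-1) = 1 := by
    refine ext_entry fun i j => ?_
    rw [entry_mul, entry_one]
    fin_cases i <;> fin_cases j <;> simp [entry, torus]
  have hb : (s (torus (-1))).base = torus (-1) := hs _
  have h1 : s (torus (-1)) * s (torus (-1)) = 1 := by rw [← map_mul, hg, map_one]
  have h2 : (s (torus (-1))).root ((s (torus (-1))).base.act basePoint) *
      (s (torus (-1))).root basePoint = 1 := congrArg (fun x => x.root basePoint) h1
  rw [hb, torus_act, ← sq, root_sq, hb, torus_denom] at h2
  norm_num at h2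

end SqrtCover

/-- A homeomorphism of connected covering groups over the base, normalized to preserve the
identity, is multiplicative: `x y ↦ e (x y)` and `x y ↦ e x * e y` lift the same map. -/
theorem IsDoubleCover.exists_continuousMulEquiv {H G X : Type*} [Group H] [TopologicalSpace H]
    [IsTopologicalGroup H] [ConnectedSpace H] [Group G] [TopologicalSpace G]
    [IsTopologicalGroup G] [Group X] [TopologicalSpace X] {p : H →* X} {q : G →* X}
    (hq : IsDoubleCover q) (e : H ≃ₜ G) (he : ∀ x, q (e x) = p x) :
    ∃ e' : H ≃ₜ* G, ∀ x, q (e' x) = p x := by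
  let e₁ : H ≃ₜ G := e.trans (Homeomorph.mulRight (e 1)⁻¹)
  have he₁ (x) : q (e₁ x) = p x := by
    change q (e x * (e 1)⁻¹) = p x
    rw [map_mul, map_inv, he, he, map_one, inv_one, mul_one]
  have h1 : e₁ 1 = 1 := mul_inv_cancel (e 1)
  have hmul : (fun x : H × H => e₁ (x.1 * x.2)) = fun x : H × H => e₁ x.1 * e₁ x.2 := by
    refine hq.isCoveringMap.eq_of_comp_eq (by fun_prop) (by fun_prop) (funext fun x => ?_)
      (1, 1) (by simp [h1])
    simp [he₁]
  exact ⟨{ e₁ with map_mul' := fun x y => congrFun hmul (x, y) }, he₁⟩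

theorem mainTheorem12 :
    -- the pairs form a topological group
    IsTopologicalGroup SqrtCover ∧
    -- the projection to `SU(2,1)(ℝ)` is a connected double cover
    Continuous SqrtCover.proj ∧
    IsDoubleCover SqrtCover.proj ∧
    ConnectedSpace SqrtCover ∧
    -- it is non-trivial as a group extension
    (¬ ∃ s : SU21 →* SqrtCover, ∀ g : SU21, SqrtCover.proj (s g) = g) ∧
    -- uniqueness, as a covering group
    (∀ (H : Type*) [Group H] [TopologicalSpace H] [IsTopologicalGroup H] [ConnectedSpace H]
      (p : H →* SU21), IsDoubleCover p →
        ∃ e : H ≃ₜ* SqrtCover, ∀ x : H, SqrtCover.proj (e x) = p x) ∧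
    -- uniqueness, as a covering space
    (∀ (E : Type*) [TopologicalSpace E] [ConnectedSpace E] (p : E → SU21), IsDoubleCover p →
        ∃ e : E ≃ₜ SqrtCover, ∀ x : E, SqrtCover.proj (e x) = p x) := by
  refine ⟨inferInstance, SqrtCover.continuous_proj, SqrtCover.isDoubleCover_proj, inferInstance,
    SqrtCover.not_exists_section, ?_, ?_⟩
  · intro H _ _ _ _ p hp
    obtain ⟨e, he⟩ := hp.exists_homeomorph SqrtCover.isDoubleCover_proj
    exact SqrtCover.isDoubleCover_proj.exists_continuousMulEquiv e he
  · intro E _ _ p hp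
    exact hp.exists_homeomorph SqrtCover.isDoubleCover_proj
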